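/- Theorem 2. For every dimension $d \ge 1$ there exist constants $c_{d,1}, c_{d,2} > 0$, depending only on $d$, such that the following holds. Let $X_1,\dots,X_n$ be i.i.d. uniformly distributed points in $[0,1]^d$. Each point $X_i$ considers each of its $\lfloor c_{d,1}\log n\rfloor$ nearest neighbours (in the Euclidean distance, among the other points), and for each such neighbour $X_j$ it creates an edge between $X_i$ and $X_j$ with probability $$p = \frac{c_{d,2}\log\log n}{\log n},$$ all these choices, one for each ordered pair $(i,j)$, being independent of each other and of the points ($p$ is replaced by the nearest point of $[0,1]$ for the small $n$ for which it is not a probability). Let $G_n$ be the resulting undirected simple graph on the $n$ points, in which an edge created from both of its endpoints counts once. Then: (i) there is a function $f$ with $f(n) = o(n)$ such that, with probability tending to $1$ as $n\to\infty$, $G_n$ has a connected component with at least $n - f(n)$ vertices; (ii) $G_n$ has of order $n\log\log n$ edges with high probability; precisely, for every $\varepsilon>0$, the probability that $$\bigl|\,|E(G_n)| - c_{d,1}c_{d,2}\, n\log\log n\,\bigr| \le \varepsilon\, n\log\log n$$ tends to $1$ as $n\to\infty$. -/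

import Mathlib

open MeasureTheory ProbabilityTheory Filter Topology Asymptotics

noncomputable section

/-- The unit cube `[0,1]^d` in Euclidean space. -/
def unitCube (d : ℕ) : Set (EuclideanSpace ℝ (Fin d)) :=
  {x | ∀ i, x i ∈ Set.Icc (0 : ℝ) 1}

/-- The uniform distribution on `[0,1]^d`: Lebesgue measure restricted to the cube. -/
def uniformCube (d : ℕ) : Measure (EuclideanSpace ℝ (Fin d)) :=
  volume.restrict (unitCube d)

/-- `x j` is one of the `k` nearest neighbours of `x i` among the other points: fewer than `k`
of the other points are strictly closer to `x i`. (If the distances from `x i` are pairwise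
distinct, exactly `min k (n - 1)` indices `j` have this property.) -/
def IsNearNeighbor {d n : ℕ} (k : ℕ) (x : Fin n → EuclideanSpace ℝ (Fin d)) (i j : Fin n) : Prop :=
  j ≠ i ∧ {l : Fin n | l ≠ i ∧ dist (x i) (x l) < dist (x i) (x j)}.ncard < k

/-- An outcome: the positions of the `n` points, and one coin for every ordered pair of points. -/
abbrev Outcome (d n : ℕ) : Type :=
  (Fin n → EuclideanSpace ℝ (Fin d)) × (Fin n × Fin n → Bool)

/-- `n` independent uniform points in `[0,1]^d` and, independently of them, one independent coin
for every ordered pair of points, each equal to `true` with probability `p`. -/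
def sampleLaw (d n : ℕ) (p : unitInterval) : Measure (Outcome d n) :=
  (Measure.pi fun _ : Fin n => uniformCube d).prod
    (Measure.pi fun _ : Fin n × Fin n => bernoulliMeasure true false p)

/-- The randomized near neighbour graph: every point `i` is joined to those of its `k` nearest
neighbours `j` for which the coin of `(i, j)` is `true`. Edges are undirected. -/
def nearNeighborGraph {d n : ℕ} (k : ℕ) (ω : Outcome d n) : SimpleGraph (Fin n) :=
  SimpleGraph.fromRel fun i j => IsNearNeighbor k ω.1 i j ∧ ω.2 (i, j) = true

/-- The number of neighbours, `c₁ log n`, rounded down. -/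
def numNeighbors (c₁ : ℝ) (n : ℕ) : ℕ := ⌊c₁ * Real.log n⌋₊

/-- The connection probability `c₂ log log n / log n`, clamped to `[0,1]` (for fixed `c₂` the value
lies in `[0,1]` already for all large `n`). -/
def connectProb (c₂ : ℝ) (n : ℕ) : unitInterval :=
  Set.projIcc 0 1 zero_le_one (c₂ * Real.log (Real.log n) / Real.log n)

end

/-! Giant component. Cut the cube into equal cells, each with a mean number of points of order `log
n`. Chernoff bounds and a union bound put every cell count within constant factors of its mean. Then
points in touching cells are near neighbours once `c₁` is a large constant
(`WellSpread.isNearNeighbor`): a ball reaching across two touching cells meets boundedly many cells,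
hence contains O(log n) points.

With the positions fixed, only the coins are random. Put `s = log n / w` with `w = (log log
n)^(1/4)`. Two sets of `s` points in touching cells have no coin showing `true` with probability at
most `exp (-p s²) = exp (-w² log n)`. This beats the `exp (O(log n))` choices of the sets and the
polynomially many pairs of cells (`measureReal_no_coin_le`). If all such pairs are joined, each cell
has one dominant component missing fewer than `s` of its points; dominant components of touching
cells coincide, so a single component misses at most `M ^ d * s ≤ n / w = o(n)` vertices
(`exists_large_component`).

Edges. Almost surely there are no ties, so exactly `n k` ordered pairs flip a relevant coin. The
number of successes is concentrated around `n k p` by Chebyshev. An edge is counted twice only for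
mutual pairs, whose expected number is at most `n k p² = o(n log log n)`
(`measureReal_abs_ncard_edgeSet_sub`). -/

/-! ### Deterministic criterion for a giant component -/

/-- If no two large disjoint subsets of `P` are without an edge between them, then all but few
vertices of `P` lie in one connected component. -/
theorem exists_component_card_sdiff_lt {V : Type*} [Fintype V] (G : SimpleGraph V)
    (P : Finset V) {s : ℝ} (hs : 0 < s) (hP : 3 * s ≤ P.card)
    (h : ∀ A ⊆ P, ∀ B ⊆ P, Disjoint A B → s ≤ A.card → s ≤ B.card →
      ∃ a ∈ A, ∃ b ∈ B, G.Adj a b) :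
    ∃ C : G.ConnectedComponent, ∀ A ⊆ P, (∀ v ∈ A, G.connectedComponentMk v ≠ C) →
      (A.card : ℝ) < s := by
  classical
  let part (U : Finset G.ConnectedComponent) : Finset V :=
    P.filter fun v => G.connectedComponentMk v ∈ U
  have part_compl (U) : ((part U).card : ℝ) + (part Uᶜ).card = P.card := by
    have := Finset.card_filter_add_card_filter_not (s := P)
      (fun v => G.connectedComponentMk v ∈ U)
    simp only [part, Finset.mem_compl]
    exact_mod_cast this
  have dich (U) : ((part U).card : ℝ) < s ∨ ((part Uᶜ).card : ℝ) < s := by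
    by_contra! hU
    obtain ⟨a, ha, b, hb, hab⟩ := h (part U) (Finset.filter_subset _ _) (part Uᶜ)
      (Finset.filter_subset _ _)
      (Finset.disjoint_filter.2 fun v _ hv hv' => (Finset.mem_compl.1 hv') hv) hU.1 hU.2
    simp only [part, Finset.mem_filter, Finset.mem_compl] at ha hb
    apply hb.2
    rw [← SimpleGraph.ConnectedComponent.sound hab.reachable]
    exact ha.2
  -- For `C` in a minimal `U`, dropping `C` breaks the defining bound, so by `dich` the rest of `U`
  -- carries fewer than `s` vertices. So does `Uᶜ`, hence `C` carries more than `3s - 2s = s`, and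
  -- `dich` makes its complement small.
  obtain ⟨U, hU, hmin⟩ := Set.Finite.exists_minimal (Set.toFinite
    {U : Finset G.ConnectedComponent | ((part Uᶜ).card : ℝ) < s})
    ⟨Finset.univ, by simpa [part] using hs⟩
  have hUne : U.Nonempty := by
    rw [Finset.nonempty_iff_ne_empty]
    rintro rfl
    have := part_compl ∅
    simp only [Set.mem_ofPred_eq] at hU
    simp [part] at this hU
    linarith
  obtain ⟨C, hC⟩ := hUne
  have herase : ((part (U.erase C)).card : ℝ) < s := by
    refine (dich _).resolve_right fun hlt => ?_
    have := hmin hlt (Finset.erase_subset _ _) hC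
    simp at this
  have hsub : P.card ≤ (part Uᶜ).card + ((part (U.erase C)).card + (part {C}).card) := by
    refine le_trans (Finset.card_le_card ?_) ((Finset.card_union_le _ _).trans
      (Nat.add_le_add_left (Finset.card_union_le _ _) _))
    intro v hv
    simp only [part, Finset.mem_union, Finset.mem_filter, Finset.mem_compl, Finset.mem_erase,
      Finset.mem_singleton]
    tauto
  have hsub' : (P.card : ℝ) ≤ (part Uᶜ).card + ((part (U.erase C)).card + (part {C}).card) := by
    exact_mod_cast hsub
  have hUs : ((part Uᶜ).card : ℝ) < s := hU
  have hC' := (dich {C}).resolve_left (by linarith)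
  refine ⟨C, fun A hA hne => lt_of_le_of_lt ?_ hC'⟩
  exact_mod_cast Finset.card_le_card fun v hv => by
    simp only [part, Finset.mem_filter, Finset.mem_compl, Finset.mem_singleton]
    exact ⟨hA hv, hne v hv⟩

/-- Two cells of the grid are equal or touch each other. -/
def CellsTouch {d : ℕ} (q r : Fin d → ℕ) : Prop :=
  ∀ i, q i ≤ r i + 1 ∧ r i ≤ q i + 1

/-- The cells of the grid with `M` cells along every side. -/
def gridCells (d M : ℕ) : Finset (Fin d → ℕ) :=
  Fintype.piFinset fun _ => Finset.range M

/-- A family that agrees on touching cells of the grid is constant. -/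
theorem grid_induction {d M : ℕ} {α : Type*} (C : (Fin d → ℕ) → α)
    (h : ∀ q ∈ gridCells d M, ∀ r ∈ gridCells d M, CellsTouch q r → C q = C r)
    {q : Fin d → ℕ} (hq : q ∈ gridCells d M) : C q = C 0 := by
  -- Lowering all coordinates at once, with truncated subtraction, is a step to a touching cell of
  -- the grid; `M` such steps reach `0`.
  have key : ∀ t : ℕ, C (fun i => q i - t) = C q := by
    intro t
    induction t with
    | zero => rfl
    | succ t ih =>
      rw [← ih]
      simp only [gridCells, Fintype.mem_piFinset, Finset.mem_range] at h hq
      refine h _ (fun i => ?_) _ (fun i => ?_) (fun i => ?_)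
      · have := hq i; omega
      · have := hq i; omega
      · omega
  rw [← key M]
  congr 1
  funext i
  simp only [gridCells, Fintype.mem_piFinset, Finset.mem_range] at hq
  have := hq i
  simp only [Pi.zero_apply]
  omega

/-- If every cell has many vertices, and any two large disjoint sets of vertices in touching cells
are joined by an edge, then one component contains all but few vertices. -/
theorem exists_large_component {V : Type*} [Fintype V] (G : SimpleGraph V) {d M : ℕ}
    (hM : 0 < M) (cell : V → Fin d → ℕ) (hcell : ∀ v, cell v ∈ gridCells d M) {s : ℝ} (hs : 0 < s)
    (hP : ∀ q ∈ gridCells d M, 3 * s ≤ ((Finset.univ.filter fun v => cell v = q).card : ℝ))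
    (h : ∀ q ∈ gridCells d M, ∀ r ∈ gridCells d M, CellsTouch q r → ∀ A B : Finset V,
      (∀ a ∈ A, cell a = q) → (∀ b ∈ B, cell b = r) → Disjoint A B →
      s ≤ A.card → s ≤ B.card → ∃ a ∈ A, ∃ b ∈ B, G.Adj a b) :
    ∃ C : G.ConnectedComponent, (Fintype.card V : ℝ) - M ^ d * s ≤ C.supp.ncard := by
  classical
  let P (q : Fin d → ℕ) : Finset V := Finset.univ.filter fun v => cell v = q
  have memP {q v} : v ∈ P q ↔ cell v = q := by simp [P]
  have hself (q : Fin d → ℕ) : CellsTouch q q := fun i => by omega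
  have hex (q : Fin d → ℕ) (hq : q ∈ gridCells d M) := exists_component_card_sdiff_lt G (P q) hs
    (hP q hq) fun A hA B hB hAB =>
      h q hq q hq (hself q) A B (fun a ha => memP.1 (hA ha)) (fun b hb => memP.1 (hB hb)) hAB
  have hne : Nonempty G.ConnectedComponent := by
    obtain ⟨C, -⟩ := hex 0 (by simp [gridCells, hM])
    exact ⟨C⟩
  choose! C hC using hex
  have hconst : ∀ q ∈ gridCells d M, ∀ r ∈ gridCells d M, CellsTouch q r → C q = C r := by
    intro q hq r hr hqr
    by_contra hCne
    let part (q : Fin d → ℕ) : Finset V := (P q).filter fun v => G.connectedComponentMk v = C q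
    -- Fewer than `s` of at least `3s` vertices lie outside `C q`.
    have hpart (q : Fin d → ℕ) (hq : q ∈ gridCells d M) : s ≤ (part q).card := by
      have h1 := Finset.card_filter_add_card_filter_not (s := P q)
        (fun v => G.connectedComponentMk v = C q)
      have h2 := hC q hq ((P q).filter fun v => ¬ G.connectedComponentMk v = C q)
        (Finset.filter_subset _ _) (by simp)
      have h3 : ((part q).card : ℝ) + ((P q).filter fun v => ¬ G.connectedComponentMk v = C q).card
        = (P q).card := by exact_mod_cast h1
      have h4 : 3 * s ≤ (P q).card := hP q hq
      linarith
    obtain ⟨a, ha, b, hb, hab⟩ := h q hq r hr hqr (part q) (part r)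
      (fun a ha => memP.1 (Finset.mem_filter.1 ha).1) (fun b hb => memP.1 (Finset.mem_filter.1 hb).1)
      (by
        rw [Finset.disjoint_left]
        intro v hv hv'
        exact hCne ((Finset.mem_filter.1 hv).2.symm.trans (Finset.mem_filter.1 hv').2))
      (hpart q hq) (hpart r hr)
    exact hCne ((Finset.mem_filter.1 ha).2.symm.trans
      ((SimpleGraph.ConnectedComponent.sound hab.reachable).trans (Finset.mem_filter.1 hb).2))
  refine ⟨C 0, ?_⟩
  let inside : Finset V := Finset.univ.filter fun v => G.connectedComponentMk v = C 0
  let outside : Finset V := Finset.univ.filter fun v => ¬ G.connectedComponentMk v = C 0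
  have hin : (C 0).supp.ncard = inside.card := by
    rw [← Set.ncard_coe_finset]
    congr 1
    ext v
    simp [inside]
  have hsum : inside.card + outside.card = Fintype.card V :=
    Finset.card_filter_add_card_filter_not (s := Finset.univ) _
  have hout : (outside.card : ℝ) ≤ M ^ d * s := by
    have h1 : outside.card = ∑ q ∈ gridCells d M, (outside.filter fun v => cell v = q).card :=
      Finset.card_eq_sum_card_fiberwise fun v _ => hcell v
    have h2 : ∀ q ∈ gridCells d M, ((outside.filter fun v => cell v = q).card : ℝ) ≤ s := by
      intro q hq
      refine (hC q hq _ (fun v hv => memP.2 (Finset.mem_filter.1 hv).2) fun v hv => ?_).le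
      rw [grid_induction C hconst hq]
      exact (Finset.mem_filter.1 (Finset.mem_filter.1 hv).1).2
    rw [h1, Nat.cast_sum]
    refine (Finset.sum_le_card_nsmul _ _ _ h2).trans_eq ?_
    simp [gridCells]
  rw [hin]
  have : (inside.card : ℝ) + outside.card = Fintype.card V := by exact_mod_cast hsum
  linarith

/-! ### Product measures and Chernoff bounds -/

/-- Bounding a set in a product by the bad first coordinates and the slices over the good ones. -/
theorem prod_real_le_add_of_slice_le {α β : Type*} [MeasurableSpace α] [MeasurableSpace β]
    (μ : Measure α) [IsProbabilityMeasure μ] (ν : Measure β) [IsProbabilityMeasure ν]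
    {S : Set (α × β)} (hS : MeasurableSet S) (B : Set α) {ε : ℝ} (hε : 0 ≤ ε)
    (h : ∀ x, x ∉ B → ν.real (Prod.mk x ⁻¹' S) ≤ ε) :
    (μ.prod ν).real S ≤ μ.real B + ε := by
  have key : μ.prod ν S ≤ μ B + ENNReal.ofReal ε := by
    rw [Measure.prod_apply hS]
    -- `B` need not be measurable; its measurable hull has the same measure.
    have hle : ∀ x, ν (Prod.mk x ⁻¹' S) ≤
        (toMeasurable μ B).indicator (fun _ => 1) x + ENNReal.ofReal ε := by
      intro x
      by_cases hx : x ∈ toMeasurable μ B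
      · rw [Set.indicator_of_mem hx]
        exact prob_le_one.trans le_self_add
      · rw [Set.indicator_of_notMem hx, zero_add, ← ofReal_measureReal]
        exact ENNReal.ofReal_le_ofReal (h x fun hxB => hx (subset_toMeasurable μ B hxB))
    refine (lintegral_mono hle).trans_eq ?_
    rw [lintegral_add_right _ measurable_const, lintegral_indicator_const
      (measurableSet_toMeasurable μ B), measure_toMeasurable]
    simp
  rw [measureReal_def, measureReal_def]
  refine (ENNReal.toReal_mono (by simp) key).trans_eq ?_
  rw [ENNReal.toReal_add (by simp) (by simp), ENNReal.toReal_ofReal hε]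

theorem bernoulli_pi_forall {ι : Type*} [Fintype ι] (p : unitInterval) (S : Finset ι) (v : Bool) :
    (Measure.pi fun _ : ι => bernoulliMeasure true false p) {b | ∀ e ∈ S, b e = v} =
      (bernoulliMeasure true false p {v}) ^ S.card := by
  classical
  have : {b : ι → Bool | ∀ e ∈ S, b e = v} =
      Set.univ.pi fun e => if e ∈ S then {v} else Set.univ := by
    ext b
    simp only [Set.mem_ofPred_eq, Set.mem_univ_pi]
    refine forall_congr' fun e => ?_
    split_ifs with he <;> simp [he]
  rw [this, Measure.pi_pi]
  simp only [apply_ite (bernoulliMeasure true false p), measure_univ]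
  rw [Finset.prod_ite]
  simp

theorem bernoulli_singleton_true (p : unitInterval) :
    bernoulliMeasure true false p {true} = ENNReal.ofReal p := by
  rw [bernoulliMeasure_apply_of_mem_of_notMem p (by simp) (by simp) (by simp)]
  rw [ENNReal.ofReal]; congr 1; ext; simp [p.2.1]

theorem bernoulli_singleton_false (p : unitInterval) :
    bernoulliMeasure true false p {false} = ENNReal.ofReal (1 - p) := by
  rw [bernoulliMeasure_apply_of_notMem_of_mem p (by simp) (by simp) (by simp)]
  rw [ENNReal.ofReal]; congr 1; ext; simp [p.2.2]

open scoped Classical in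
/-- The exponential moment of a binomial count. -/
theorem integral_pow_card_filter {α : Type*} [MeasurableSpace α] (μ : Measure α)
    [IsProbabilityMeasure μ] {B : Set α} (hB : MeasurableSet B) (n : ℕ) (t : ℝ) :
    ∫ x : Fin n → α, t ^ (Finset.univ.filter fun i => x i ∈ B).card ∂(Measure.pi fun _ => μ) =
      (1 + (t - 1) * μ.real B) ^ n := by
  -- The power is a product of functions of single coordinates, so its integral factorises.
  have h1 (x : Fin n → α) : t ^ (Finset.univ.filter fun i => x i ∈ B).card =
      ∏ i, (1 + B.indicator (fun _ => t - 1) (x i)) := by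
    rw [← Finset.prod_const, Finset.prod_filter]
    refine Finset.prod_congr rfl fun i _ => ?_
    by_cases hi : x i ∈ B <;> simp [hi]
  simp_rw [h1]
  rw [integral_fintype_prod_eq_prod (𝕜 := ℝ)
    (f := fun _ x => 1 + B.indicator (fun _ => t - 1) x)]
  rw [integral_add (integrable_const _) ((integrable_const _).indicator hB),
    integral_indicator_const _ hB]
  simp [mul_comm]

open scoped Classical in
/-- Markov's inequality for the exponential moment of a binomial count. -/
theorem measureReal_le_mul_card_filter {α : Type*} [MeasurableSpace α] (μ : Measure α)
    [IsProbabilityMeasure μ] {B : Set α} (hB : MeasurableSet B) (n : ℕ) (u v : ℝ) :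
    (Measure.pi fun _ : Fin n => μ).real
        {x | v ≤ u * (Finset.univ.filter fun i => x i ∈ B).card} ≤
      Real.exp (n * ((Real.exp u - 1) * μ.real B) - v) := by
  have hmeas : Measurable fun x : Fin n → α => Real.exp u ^
      (Finset.univ.filter fun i => x i ∈ B).card := by
    have : (fun x : Fin n → α => Real.exp u ^ (Finset.univ.filter fun i => x i ∈ B).card) =
        fun x => ∏ i, (1 + B.indicator (fun _ => Real.exp u - 1) (x i)) := by
      funext x
      rw [← Finset.prod_const, Finset.prod_filter]
      refine Finset.prod_congr rfl fun i _ => ?_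
      by_cases hi : x i ∈ B <;> simp [hi]
    rw [this]
    exact Finset.measurable_prod _ fun i _ =>
      ((measurable_const.indicator hB).comp (measurable_pi_apply i)).const_add 1
  have hint : Integrable (fun x : Fin n → α => Real.exp u ^
      (Finset.univ.filter fun i => x i ∈ B).card) (Measure.pi fun _ => μ) := by
    refine Integrable.of_bound (C := max 1 (Real.exp u) ^ n) hmeas.aestronglyMeasurable
      (Eventually.of_forall fun x => ?_)
    rw [Real.norm_of_nonneg (by positivity)]
    have hcard : (Finset.univ.filter fun i => x i ∈ B).card ≤ n :=
      (Finset.card_le_univ _).trans_eq (Fintype.card_fin n)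
    exact (pow_le_pow_left₀ (Real.exp_pos u).le (le_max_right _ _) _).trans
      (pow_le_pow_right₀ (le_max_left _ _) hcard)
  have hmarkov := mul_meas_ge_le_integral_of_nonneg
    (Eventually.of_forall fun x => by positivity) hint (Real.exp v)
  rw [integral_pow_card_filter μ hB n] at hmarkov
  -- This is `1 + z ≤ exp z`; the base is nonnegative since `exp u - 1 > -1` and `μ.real B ≤ 1`.
  have hpow : (1 + (Real.exp u - 1) * μ.real B) ^ n ≤
      Real.exp (n * ((Real.exp u - 1) * μ.real B)) := by
    rw [Real.exp_nat_mul]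
    refine pow_le_pow_left₀ ?_ ?_ n
    · nlinarith [Real.exp_pos u, measureReal_nonneg (μ := μ) (s := B),
        measureReal_le_one (μ := μ) (s := B)]
    · linarith [Real.add_one_le_exp ((Real.exp u - 1) * μ.real B)]
  rw [Real.exp_sub, le_div_iff₀ (Real.exp_pos v), mul_comm]
  refine le_trans (le_of_eq ?_) (hmarkov.trans hpow)
  congr 2
  ext x
  simp only [Set.mem_ofPred_eq]
  rw [← Real.exp_nat_mul, Real.exp_le_exp, mul_comm]

open scoped Classical in
/-- A binomial count is unlikely to be three times its mean. -/
theorem measureReal_card_filter_ge {α : Type*} [MeasurableSpace α] (μ : Measure α)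
    [IsProbabilityMeasure μ] {B : Set α} (hB : MeasurableSet B) (n : ℕ) :
    (Measure.pi fun _ : Fin n => μ).real
        {x | 3 * (n * μ.real B) ≤ (Finset.univ.filter fun i => x i ∈ B).card} ≤
      Real.exp (-(n * μ.real B) / 3) := by
  -- With `u = 1` the exponent is `e - 1 - 3 < -1/3` times the mean.
  have h := measureReal_le_mul_card_filter μ hB n 1 (3 * (n * μ.real B))
  simp only [one_mul] at h
  refine h.trans (Real.exp_le_exp.2 ?_)
  have h0 : 0 ≤ n * μ.real B := by positivity
  nlinarith [Real.exp_one_lt_d9]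

open scoped Classical in
/-- A binomial count is unlikely to be a quarter of its mean. -/
theorem measureReal_card_filter_le {α : Type*} [MeasurableSpace α] (μ : Measure α)
    [IsProbabilityMeasure μ] {B : Set α} (hB : MeasurableSet B) (n : ℕ) :
    (Measure.pi fun _ : Fin n => μ).real
        {x | ((Finset.univ.filter fun i => x i ∈ B).card : ℝ) ≤ n * μ.real B / 4} ≤
      Real.exp (-(n * μ.real B) / 3) := by
  -- With `u = -1` the exponent is `e⁻¹ - 1 + 1/4 < -1/3` times the mean.
  have h := measureReal_le_mul_card_filter μ hB n (-1) (-(n * μ.real B / 4))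
  simp only [neg_mul, one_mul, neg_le_neg_iff] at h
  refine h.trans (Real.exp_le_exp.2 ?_)
  have h0 : 0 ≤ n * μ.real B := by positivity
  have h1 : Real.exp (-1) ≤ 0.37 := by linarith [Real.exp_neg_one_lt_d9]
  nlinarith

/-! ### Grid cells and well spread configurations -/

/-- The cell of side `1 / M` that contains a point of the positive orthant. -/
noncomputable def cellOf {d : ℕ} (M : ℕ) (x : EuclideanSpace ℝ (Fin d)) : Fin d → ℕ :=
  fun i => ⌊M * x i⌋₊

theorem measurable_cellOf {d : ℕ} (M : ℕ) :
    Measurable (cellOf M : EuclideanSpace ℝ (Fin d) → Fin d → ℕ) := by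
  refine measurable_pi_lambda _ fun i => Nat.measurable_floor.comp ?_
  fun_prop

theorem volume_box {d : ℕ} (a : Fin d → ℝ) {s : ℝ} (I : ℝ → Set ℝ)
    (hI : ∀ a, volume (I a) = ENNReal.ofReal s) (hm : ∀ a, MeasurableSet (I a)) :
    volume {x : EuclideanSpace ℝ (Fin d) | ∀ i, x i ∈ I (a i)} = ENNReal.ofReal s ^ d := by
  have h : {x : EuclideanSpace ℝ (Fin d) | ∀ i, x i ∈ I (a i)} =
      (WithLp.ofLp) ⁻¹' (Set.univ.pi fun i => I (a i)) := by
    ext x; simp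
  rw [h, (PiLp.volume_preserving_ofLp (Fin d)).measure_preimage
    (MeasurableSet.univ_pi fun i => hm _).nullMeasurableSet, volume_pi_pi]
  simp [hI]

instance isProbabilityMeasure_uniformCube (d : ℕ) : IsProbabilityMeasure (uniformCube d) := by
  constructor
  rw [uniformCube, Measure.restrict_apply_univ, unitCube]
  have := volume_box (fun _ : Fin d => (0 : ℝ)) (s := 1) (fun a => Set.Icc a (a + 1))
    (by simp) fun _ => measurableSet_Icc
  simpa using this

theorem uniformCube_cell {d M : ℕ} (hM : 0 < M) {q : Fin d → ℕ} (hq : q ∈ gridCells d M) :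
    (uniformCube d).real (cellOf M ⁻¹' {q}) = ((M : ℝ) ^ d)⁻¹ := by
  have hM' : (0 : ℝ) < M := by exact_mod_cast hM
  rw [measureReal_def, uniformCube,
    Measure.restrict_apply (measurable_cellOf M (measurableSet_singleton q))]
  -- The natural floor sends negative numbers to `0`, so the cube is needed to bound the cell from
  -- below; from above `q i + 1 ≤ M` keeps the box inside the cube.
  have h : cellOf M ⁻¹' {q} ∩ unitCube d = {x : EuclideanSpace ℝ (Fin d) |
      ∀ i, x i ∈ Set.Ico ((q i : ℝ) / M) (q i / M + (M : ℝ)⁻¹)} := by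
    ext x
    simp only [Set.mem_inter_iff, Set.mem_preimage, Set.mem_singleton_iff, unitCube,
      Set.mem_ofPred_eq, cellOf, funext_iff, ← forall_and]
    refine forall_congr' fun i => ?_
    have hqi : (q i : ℝ) + 1 ≤ M := by
      exact_mod_cast Finset.mem_range.1 (Fintype.mem_piFinset.1 hq i)
    have e : (q i : ℝ) / M + (M : ℝ)⁻¹ = (q i + 1) / M := by rw [add_div, one_div]
    rw [e, Set.mem_Ico, div_le_iff₀ hM', lt_div_iff₀ hM', mul_comm (x i)]
    constructor
    · rintro ⟨h1, h2⟩
      exact (Nat.floor_eq_iff (mul_nonneg hM'.le h2.1)).1 h1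
    · rintro ⟨h1, h2⟩
      have h0 : 0 ≤ (M : ℝ) * x i := le_trans (by positivity) h1
      refine ⟨(Nat.floor_eq_iff h0).2 ⟨h1, h2⟩, ?_, ?_⟩
      · exact nonneg_of_mul_nonneg_right h0 hM'
      · nlinarith
  rw [h, volume_box (fun i => (q i : ℝ) / M) (s := (M : ℝ)⁻¹) (fun a => Set.Ico a (a + (M : ℝ)⁻¹))
    (by simp) fun _ => measurableSet_Ico]
  rw [ENNReal.toReal_pow, ENNReal.toReal_ofReal (by positivity), inv_pow]

/-- The `M ^ d` disjoint cells have mass `M ^ (-d)` each. The points of the cube left out have a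
coordinate equal to `1`. -/
theorem ae_cellOf_mem {d M : ℕ} (hM : 0 < M) :
    ∀ᵐ x ∂uniformCube d, cellOf M x ∈ gridCells d M := by
  have hms : MeasurableSet (cellOf M ⁻¹' (gridCells d M : Set (Fin d → ℕ)) :
      Set (EuclideanSpace ℝ (Fin d))) := measurable_cellOf M (Finset.measurableSet _)
  refine (mem_ae_iff_prob_eq_one (μ := uniformCube d) hms).2 ?_
  have h : cellOf M ⁻¹' (gridCells d M : Set (Fin d → ℕ)) =
      ⋃ q ∈ gridCells d M, (cellOf M ⁻¹' {q} : Set (EuclideanSpace ℝ (Fin d))) := by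
    ext x; simp
  have hr : (uniformCube d).real (cellOf M ⁻¹' (gridCells d M : Set (Fin d → ℕ))) = 1 := by
    rw [h, measureReal_biUnion_finset
      (fun q _ r _ hqr => Disjoint.preimage _ (Set.disjoint_singleton.2 hqr))
      fun q _ => measurable_cellOf M (measurableSet_singleton q)]
    rw [Finset.sum_congr rfl fun q hq => uniformCube_cell hM hq]
    have hM' : (M : ℝ) ^ d ≠ 0 := by positivity
    simp [gridCells, hM']
  have hone := ofReal_measureReal (μ := uniformCube d)
    (s := cellOf M ⁻¹' (gridCells d M : Set (Fin d → ℕ)))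
  rw [hr, ENNReal.ofReal_one] at hone
  exact hone.symm

open scoped Classical in
/-- The number of points of the configuration `x` in the cell `q`. -/
noncomputable def cellCount {d n : ℕ} (M : ℕ) (x : Fin n → EuclideanSpace ℝ (Fin d))
    (q : Fin d → ℕ) : ℕ :=
  (Finset.univ.filter fun v => x v ∈ cellOf M ⁻¹' {q}).card

/-- All points lie in the cells of the grid, and the number of points in every cell is of the
order of its mean. -/
def WellSpread {d n : ℕ} (M : ℕ) (x : Fin n → EuclideanSpace ℝ (Fin d)) : Prop :=
  (∀ v, x v ∈ unitCube d ∧ cellOf M (x v) ∈ gridCells d M) ∧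
    ∀ q ∈ gridCells d M, (n : ℝ) / M ^ d / 4 ≤ cellCount M x q ∧
      (cellCount M x q : ℝ) ≤ 3 * (n / M ^ d)

theorem measurableSet_unitCube (d : ℕ) : MeasurableSet (unitCube d) := by
  have : unitCube d = ⋂ i, (fun x : EuclideanSpace ℝ (Fin d) => x i) ⁻¹' Set.Icc 0 1 := by
    ext x; simp [unitCube]
  rw [this]
  refine MeasurableSet.iInter fun i => ?_
  exact (by fun_prop : Measurable fun x : EuclideanSpace ℝ (Fin d) => x i) measurableSet_Icc

/-- A configuration of uniform points is very likely well spread. -/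
theorem measureReal_not_wellSpread_le {d n M : ℕ} (hM : 0 < M) :
    (Measure.pi fun _ : Fin n => uniformCube d).real {x | ¬ WellSpread M x} ≤
      M ^ d * (2 * Real.exp (-(n / M ^ d) / 3)) := by
  classical
  have hae : ∀ᵐ x ∂(Measure.pi fun _ : Fin n => uniformCube d),
      ∀ v, x v ∈ unitCube d ∧ cellOf M (x v) ∈ gridCells d M := by
    rw [ae_all_iff]
    intro v
    have := (ae_restrict_mem (measurableSet_unitCube d) (μ := volume)).and (ae_cellOf_mem hM)
    exact (measurePreserving_eval (fun _ : Fin n => uniformCube d) v).quasiMeasurePreserving.ae this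
  let E (q : Fin d → ℕ) : Set (Fin n → EuclideanSpace ℝ (Fin d)) :=
    {x | (cellCount M x q : ℝ) ≤ n / M ^ d / 4} ∪ {x | 3 * (n / M ^ d : ℝ) ≤ cellCount M x q}
  have hE : ∀ q ∈ gridCells d M, (Measure.pi fun _ : Fin n => uniformCube d).real (E q) ≤
      2 * Real.exp (-(n / M ^ d) / 3) := by
    intro q hq
    have hB := measurable_cellOf (d := d) M (measurableSet_singleton q)
    have h1 := measureReal_card_filter_le (uniformCube d) hB n
    have h2 := measureReal_card_filter_ge (uniformCube d) hB n
    rw [uniformCube_cell hM hq, ← div_eq_mul_inv] at h1 h2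
    rw [two_mul]
    exact (measureReal_union_le _ _).trans (add_le_add h1 h2)
  have hsub : (Measure.pi fun _ : Fin n => uniformCube d).real {x | ¬ WellSpread M x} ≤
      (Measure.pi fun _ : Fin n => uniformCube d).real (⋃ q ∈ gridCells d M, E q) := by
    -- The inclusion holds only almost everywhere, as the points lie in the cube and the grid only
    -- almost surely.
    refine ENNReal.toReal_mono (measure_ne_top _ _) (measure_mono_ae ?_)
    filter_upwards [hae] with x hx hxs
    by_contra hcon
    refine hxs ⟨hx, fun q hq => ?_⟩
    have hq' : x ∉ E q := fun h => hcon (Set.mem_biUnion hq h)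
    simp only [E, Set.mem_union, Set.mem_ofPred_eq, not_or, not_le] at hq'
    exact ⟨hq'.1.le, hq'.2.le⟩
  refine hsub.trans ((measureReal_biUnion_finset_le _ _).trans
    ((Finset.sum_le_card_nsmul _ _ _ hE).trans_eq ?_))
  simp [gridCells]

/-- The Euclidean norm is at most the sum of the absolute coordinates; the crude factor `d` only
affects constants. -/
theorem dist_le_of_forall_abs_sub_le {d : ℕ} {x y : EuclideanSpace ℝ (Fin d)} {r : ℝ}
    (h : ∀ i, |x i - y i| ≤ r) : dist x y ≤ d * r := by
  have hsum : ∑ i : Fin d, |x i - y i| ≤ d * r := by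
    refine (Finset.sum_le_card_nsmul _ _ _ fun i _ => h i).trans_eq ?_
    simp
  refine le_trans ?_ hsum
  rw [EuclideanSpace.dist_eq, Real.sqrt_le_left (Finset.sum_nonneg fun i _ => abs_nonneg _)]
  simp only [Real.dist_eq]
  exact Finset.sum_sq_le_sq_sum_of_nonneg fun i _ => abs_nonneg _

theorem abs_sub_le_dist {d : ℕ} (x y : EuclideanSpace ℝ (Fin d)) (i : Fin d) :
    |x i - y i| ≤ dist x y := by
  rw [dist_eq_norm]
  simpa using PiLp.norm_apply_le (x - y) i

/-- In a well spread configuration, points in touching cells are near neighbours. -/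
theorem WellSpread.isNearNeighbor {d n M k : ℕ} (hM : 0 < M)
    {x : Fin n → EuclideanSpace ℝ (Fin d)} (hx : WellSpread M x)
    (hk : (4 * d + 1 : ℝ) ^ d * (3 * (n / M ^ d)) < k) {i j : Fin n} (hij : j ≠ i)
    (hcell : CellsTouch (cellOf M (x i)) (cellOf M (x j))) : IsNearNeighbor k x i j := by
  classical
  refine ⟨hij, ?_⟩
  have hM' : (0 : ℝ) < M := by exact_mod_cast hM
  have hpos (v : Fin n) (c : Fin d) : 0 ≤ (M : ℝ) * x v c := mul_nonneg hM'.le ((hx.1 v).1 c).1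
  have hdist : dist (x i) (x j) ≤ d * (2 / M) := by
    refine dist_le_of_forall_abs_sub_le fun c => ?_
    have hscale : |x i c - x j c| * M = |((M : ℝ) * x i c) - M * x j c| := by
      rw [← mul_sub, abs_mul, abs_of_pos hM', mul_comm]
    rw [le_div_iff₀ hM', hscale, abs_le]
    have h1 := Nat.floor_le (hpos i c)
    have h2 := Nat.floor_le (hpos j c)
    have h3 := Nat.lt_floor_add_one ((M : ℝ) * x i c)
    have h4 := Nat.lt_floor_add_one ((M : ℝ) * x j c)
    have h5 : (⌊(M : ℝ) * x i c⌋₊ : ℝ) ≤ ⌊(M : ℝ) * x j c⌋₊ + 1 := by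
      exact_mod_cast (hcell c).1
    have h6 : (⌊(M : ℝ) * x j c⌋₊ : ℝ) ≤ ⌊(M : ℝ) * x i c⌋₊ + 1 := by
      exact_mod_cast (hcell c).2
    constructor <;> linarith
  -- A point closer to `x i` than `x j` differs from `x i` by at most `2 d / M` in each coordinate,
  -- so its cell index moves by at most `2 d`. Truncated subtraction only shortens the interval.
  let box : Finset (Fin d → ℕ) := Fintype.piFinset fun c =>
    Finset.Icc (cellOf M (x i) c - 2 * d) (cellOf M (x i) c + 2 * d)
  have hbox : box.card ≤ (4 * d + 1) ^ d := by
    rw [Fintype.card_piFinset]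
    refine (Finset.prod_le_pow_card _ _ (4 * d + 1) fun c _ => ?_).trans_eq (by simp)
    rw [Nat.card_Icc]
    omega
  let near : Finset (Fin n) :=
    Finset.univ.filter fun l => l ≠ i ∧ dist (x i) (x l) < dist (x i) (x j)
  have hnear : {l : Fin n | l ≠ i ∧ dist (x i) (x l) < dist (x i) (x j)}.ncard = near.card := by
    rw [← Set.ncard_coe_finset]
    congr 1
    ext l
    simp [near]
  have hmem : ∀ l ∈ near, cellOf M (x l) ∈ box ∩ gridCells d M := by
    intro l hl
    refine Finset.mem_inter.2 ⟨Fintype.mem_piFinset.2 fun c => ?_, (hx.1 l).2⟩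
    have h1 : |x i c - x l c| ≤ d * (2 / M) :=
      (abs_sub_le_dist _ _ c).trans ((Finset.mem_filter.1 hl).2.2.le.trans hdist)
    have h2 : |(M : ℝ) * x i c - M * x l c| ≤ 2 * d := by
      rw [← mul_sub, abs_mul, abs_of_pos hM']
      refine (mul_le_mul_of_nonneg_left h1 hM'.le).trans_eq ?_
      field_simp
    rw [abs_le] at h2
    have h3 : ⌊(M : ℝ) * x i c⌋₊ ≤ ⌊(M : ℝ) * x l c⌋₊ + 2 * d := by
      rw [← Nat.floor_add_natCast (hpos l c)]
      exact Nat.floor_mono (by push_cast; linarith)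
    have h4 : ⌊(M : ℝ) * x l c⌋₊ ≤ ⌊(M : ℝ) * x i c⌋₊ + 2 * d := by
      rw [← Nat.floor_add_natCast (hpos i c)]
      exact Nat.floor_mono (by push_cast; linarith)
    rw [Finset.mem_Icc]
    simp only [cellOf]
    omega
  rw [hnear]
  have hcard : (near.card : ℝ) ≤ (4 * d + 1 : ℝ) ^ d * (3 * (n / M ^ d)) := by
    rw [Finset.card_eq_sum_card_fiberwise hmem, Nat.cast_sum]
    have hle : ∀ q ∈ box ∩ gridCells d M,
        ((near.filter fun l => cellOf M (x l) = q).card : ℝ) ≤ 3 * (n / M ^ d) := by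
      intro q hq
      refine le_trans ?_ (hx.2 q (Finset.mem_inter.1 hq).2).2
      refine Nat.cast_le.2 (Finset.card_le_card fun l hl => ?_)
      exact Finset.mem_filter.2 ⟨Finset.mem_univ l, (Finset.mem_filter.1 hl).2⟩
    refine (Finset.sum_le_card_nsmul _ _ _ hle).trans ?_
    rw [nsmul_eq_mul]
    refine mul_le_mul_of_nonneg_right ?_ (by positivity)
    exact_mod_cast (Finset.card_le_card Finset.inter_subset_left).trans hbox
  exact_mod_cast hcard.trans_lt hk

/-! ### Coins for fixed positions -/

/-- The positions enter only through finitely many comparisons of distances, and every function of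
finitely many truth values is measurable. -/
theorem measurable_isNearNeighbor {d n : ℕ} (k : ℕ) :
    Measurable fun x : Fin n → EuclideanSpace ℝ (Fin d) => IsNearNeighbor k x := by
  refine measurable_pi_lambda _ fun i => measurable_pi_lambda _ fun j => ?_
  have hcloser : Measurable fun (x : Fin n → EuclideanSpace ℝ (Fin d)) (l : Fin n) =>
      dist (x i) (x l) < dist (x i) (x j) := by
    refine measurable_pi_lambda _ fun l => measurableSet_setOfPred.1 (measurableSet_lt ?_ ?_)
    · exact (measurable_pi_apply i).dist (measurable_pi_apply l)
    · exact (measurable_pi_apply i).dist (measurable_pi_apply j)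
  have hF : Measurable fun K : Fin n → Prop => j ≠ i ∧ {l : Fin n | l ≠ i ∧ K l}.ncard < k :=
    measurable_of_finite _
  exact hF.comp hcloser

/-- Every event that depends only on the near neighbour relation and the coins is measurable. -/
theorem measurableSet_isNearNeighbor_coins {d n : ℕ} (k : ℕ)
    (S : (Fin n → Fin n → Prop) → (Fin n × Fin n → Bool) → Prop) :
    MeasurableSet {ω : Outcome d n | S (IsNearNeighbor k ω.1) ω.2} := by
  have hm : Measurable fun ω : Outcome d n => (IsNearNeighbor k ω.1, ω.2) :=
    ((measurable_isNearNeighbor k).comp measurable_fst).prodMk measurable_snd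
  exact hm (t := {z | S z.1 z.2}) (Set.toFinite _).measurableSet

theorem measureReal_coins_false (n : ℕ) (p : unitInterval) (S : Finset (Fin n × Fin n)) :
    (Measure.pi fun _ : Fin n × Fin n => bernoulliMeasure true false p).real
      {b | ∀ e ∈ S, b e = false} ≤ Real.exp (-(p * S.card)) := by
  rw [measureReal_def, bernoulli_pi_forall, bernoulli_singleton_false, ENNReal.toReal_pow,
    ENNReal.toReal_ofReal (by linarith [p.2.2]), mul_comm, ← mul_neg, Real.exp_nat_mul]
  exact pow_le_pow_left₀ (by linarith [p.2.2]) (by linarith [Real.add_one_le_exp (-(p : ℝ))]) _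

/-- It is unlikely that two large sets of points in touching cells have no coin between them that
shows `true`. -/
theorem measureReal_no_coin_le {n d M : ℕ} (p : unitInterval) (cell : Fin n → Fin d → ℕ) {s T : ℝ}
    (hs : 0 ≤ s)
    (hT : ∀ q ∈ gridCells d M, ((Finset.univ.filter fun v => cell v = q).card : ℝ) ≤ T) :
    (Measure.pi fun _ : Fin n × Fin n => bernoulliMeasure true false p).real
      {b | ∃ q ∈ gridCells d M, ∃ r ∈ gridCells d M, ∃ A B : Finset (Fin n),
        (∀ a ∈ A, cell a = q) ∧ (∀ b ∈ B, cell b = r) ∧ s ≤ A.card ∧ s ≤ B.card ∧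
          ∀ e ∈ A ×ˢ B, b e = false} ≤
      (M ^ d) ^ 2 * Real.exp (2 * T - p * s ^ 2) := by
  classical
  let P (q : Fin d → ℕ) : Finset (Fin n) := Finset.univ.filter fun v => cell v = q
  -- The size conditions are part of the event, so pairs of small sets contribute the empty set to
  -- the union bound.
  let E (A B : Finset (Fin n)) : Set (Fin n × Fin n → Bool) :=
    {b | s ≤ A.card ∧ s ≤ B.card ∧ ∀ e ∈ A ×ˢ B, b e = false}
  set ν := Measure.pi fun _ : Fin n × Fin n => bernoulliMeasure true false p
  have hE (A B : Finset (Fin n)) : ν.real (E A B) ≤ Real.exp (-(p * s ^ 2)) := by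
    by_cases hAB : s ≤ A.card ∧ s ≤ B.card
    · refine (measureReal_mono (fun b hb => hb.2.2)).trans
        ((measureReal_coins_false n p (A ×ˢ B)).trans (Real.exp_le_exp.2 (neg_le_neg ?_)))
      refine mul_le_mul_of_nonneg_left ?_ p.2.1
      rw [Finset.card_product, Nat.cast_mul, sq]
      exact mul_le_mul hAB.1 hAB.2 hs (Nat.cast_nonneg _)
    · have : E A B = ∅ := by
        ext b
        simp only [E, Set.mem_ofPred_eq, Set.mem_empty_iff_false, iff_false]
        exact fun h => hAB ⟨h.1, h.2.1⟩
      rw [this, measureReal_empty]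
      positivity
  -- Subsets of one cell number at most `2 ^ T ≤ exp T`; the pair `A`, `B` therefore costs `exp (2 *
  -- T)`.
  have hpow {q} (hq : q ∈ gridCells d M) : ((P q).powerset.card : ℝ) ≤ Real.exp T := by
    rw [Finset.card_powerset, Nat.cast_pow, Nat.cast_ofNat]
    calc (2 : ℝ) ^ (P q).card ≤ Real.exp 1 ^ (P q).card :=
          pow_le_pow_left₀ (by norm_num) (by linarith [Real.exp_one_gt_d9]) _
      _ = Real.exp (P q).card := by rw [← Real.exp_nat_mul, mul_one]
      _ ≤ Real.exp T := Real.exp_le_exp.2 (hT q hq)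
  let I (z : (Fin d → ℕ) × (Fin d → ℕ)) : Finset (Finset (Fin n) × Finset (Fin n)) :=
    (P z.1).powerset ×ˢ (P z.2).powerset
  have hsub : {b | ∃ q ∈ gridCells d M, ∃ r ∈ gridCells d M, ∃ A B : Finset (Fin n),
      (∀ a ∈ A, cell a = q) ∧ (∀ b ∈ B, cell b = r) ∧ s ≤ A.card ∧ s ≤ B.card ∧
        ∀ e ∈ A ×ˢ B, b e = false} ⊆
      ⋃ z ∈ gridCells d M ×ˢ gridCells d M, ⋃ w ∈ I z, E w.1 w.2 := by
    rintro b ⟨q, hq, r, hr, A, B, hA, hB, h⟩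
    refine Set.mem_biUnion (x := (q, r)) (Finset.mem_coe.2 (Finset.mk_mem_product hq hr))
      (Set.mem_biUnion (x := (A, B)) (Finset.mem_coe.2 (Finset.mk_mem_product ?_ ?_)) h)
    · exact Finset.mem_powerset.2 fun a ha => by simp [P, hA a ha]
    · exact Finset.mem_powerset.2 fun a ha => by simp [P, hB a ha]
  refine (measureReal_mono hsub (measure_ne_top ν _)).trans ((measureReal_biUnion_finset_le _ _).trans ?_)
  have hz : ∀ z ∈ gridCells d M ×ˢ gridCells d M,
      ν.real (⋃ w ∈ I z, E w.1 w.2) ≤ Real.exp (2 * T - p * s ^ 2) := by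
    intro z hz
    refine (measureReal_biUnion_finset_le _ _).trans
      ((Finset.sum_le_card_nsmul _ _ _ fun w _ => hE w.1 w.2).trans ?_)
    rw [nsmul_eq_mul, Finset.card_product, Nat.cast_mul, sub_eq_add_neg, Real.exp_add, two_mul,
      Real.exp_add]
    exact mul_le_mul_of_nonneg_right (mul_le_mul (hpow (Finset.mem_product.1 hz).1)
      (hpow (Finset.mem_product.1 hz).2) (Nat.cast_nonneg _) (Real.exp_pos _).le)
      (Real.exp_pos _).le
  refine (Finset.sum_le_card_nsmul _ _ _ hz).trans_eq ?_
  simp [gridCells, sq]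

/-- For a well spread configuration, the near neighbour graph very likely has a giant component. -/
theorem WellSpread.measureReal_no_giant_le {d n M k : ℕ} (hM : 0 < M) (p : unitInterval)
    {x : Fin n → EuclideanSpace ℝ (Fin d)} (hx : WellSpread M x)
    (hk : (4 * d + 1 : ℝ) ^ d * (3 * (n / M ^ d)) < k) {s : ℝ} (hs : 0 < s)
    (hsn : 3 * s ≤ n / M ^ d / 4) :
    (Measure.pi fun _ : Fin n × Fin n => bernoulliMeasure true false p).real
      {b | ¬ ∃ C : (nearNeighborGraph k (x, b)).ConnectedComponent,
        (n : ℝ) - M ^ d * s ≤ C.supp.ncard} ≤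
      (M ^ d) ^ 2 * Real.exp (2 * (3 * (n / M ^ d)) - p * s ^ 2) := by
  classical
  have hcount (q : Fin d → ℕ) : cellCount M x q =
      (Finset.univ.filter fun v => cellOf M (x v) = q).card := by
    unfold cellCount
    congr 1
    ext v
    simp
  refine le_trans (measureReal_mono fun b hb => ?_)
    (measureReal_no_coin_le p (fun v => cellOf M (x v)) hs.le
      fun q hq => by rw [← hcount]; exact (hx.2 q hq).2)
  by_contra hcon
  apply hb
  have := exists_large_component (nearNeighborGraph k (x, b)) hM (fun v => cellOf M (x v))
    (fun v => (hx.1 v).2) hs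
    (fun q hq => by rw [← hcount]; exact hsn.trans (hx.2 q hq).1) ?_
  · simpa using this
  intro q hq r hr hqr A B hA hB hAB hsA hsB
  by_contra! hno
  refine hcon ⟨q, hq, r, hr, A, B, hA, hB, hsA, hsB, fun e he => ?_⟩
  obtain ⟨ha, hb'⟩ := Finset.mem_product.1 he
  -- The coin of the pair directed from `A` to `B` already suffices; disjointness makes its
  -- endpoints distinct.
  by_contra hcoin
  have hne : e.2 ≠ e.1 := fun h => Finset.disjoint_left.1 hAB ha (h ▸ hb')
  refine hno e.1 ha e.2 hb' ?_
  rw [nearNeighborGraph, SimpleGraph.fromRel_adj]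
  refine ⟨hne.symm, Or.inl ⟨hx.isNearNeighbor hM hk hne ?_, by simpa using hcoin⟩⟩
  rw [hA _ ha, hB _ hb']
  exact hqr

/-! ### Counting edges -/

/-- Almost surely, all distances from a point of the sample to the others are distinct. -/
theorem ae_injOn_dist {d : ℕ} (hd : 1 ≤ d) (n : ℕ) :
    ∀ᵐ x ∂(Measure.pi fun _ : Fin n => uniformCube d),
      ∀ i j l, j ≠ i → l ≠ i → dist (x i) (x j) = dist (x i) (x l) → j = l := by
  simp only [ae_all_iff]
  intro i j l hji hli
  by_cases hjl : j = l
  · exact Eventually.of_forall fun _ _ => hjl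
  obtain _ | m := n
  · exact i.elim0
  have : Nonempty (Fin d) := ⟨⟨0, hd⟩⟩
  have hmp := measurePreserving_piFinSuccAbove (fun _ : Fin (m + 1) => uniformCube d) l
  obtain ⟨i', rfl⟩ := Fin.exists_succAbove_eq hli.symm
  obtain ⟨j', rfl⟩ := Fin.exists_succAbove_eq hjl
  let S : Set (EuclideanSpace ℝ (Fin d) × (Fin m → EuclideanSpace ℝ (Fin d))) :=
    {z | dist (z.2 i') (z.2 j') = dist (z.2 i') z.1}
  have hS : MeasurableSet S :=
    measurableSet_eq_fun (((measurable_pi_apply i').comp measurable_snd).dist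
      ((measurable_pi_apply j').comp measurable_snd))
      (((measurable_pi_apply i').comp measurable_snd).dist measurable_fst)
  -- Given the other points, a tie forces point `l` onto a sphere, which is Lebesgue null even for
  -- radius zero because `d ≥ 1`.
  have hzero : (uniformCube d).prod (Measure.pi fun _ : Fin m => uniformCube d) S = 0 := by
    rw [Measure.prod_apply_symm hS, lintegral_eq_zero_iff' (by
      exact (measurable_measure_prodMk_right hS).aemeasurable)]
    refine Eventually.of_forall fun y => ?_
    refine measure_mono_null (t := Metric.sphere (y i') (dist (y i') (y j'))) (fun z hz => ?_) ?_
    · rw [Metric.mem_sphere, dist_comm]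
      exact (Eq.symm hz)
    · exact Measure.absolutelyContinuous_of_le Measure.restrict_le_self
        (Measure.addHaar_sphere volume _ _)
  have hae : ∀ᵐ z ∂(uniformCube d).prod (Measure.pi fun _ : Fin m => uniformCube d), z ∉ S :=
    measure_eq_zero_iff_ae_notMem.1 hzero
  filter_upwards [hmp.quasiMeasurePreserving.ae hae] with x hx heq
  exact (hx heq).elim

open scoped Classical in
/-- If `f` is injective on a finite set, then the number of elements with fewer than `k` elements
strictly below them is `k`, or the size of the set if that is smaller. -/
theorem card_filter_card_lt {α : Type*} (s : Finset α) (f : α → ℝ) (hf : Set.InjOn f s) (k : ℕ)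
    (hk : k ≤ s.card) :
    (s.filter fun a => (s.filter fun b => f b < f a).card < k).card = k := by
  let rank (a : α) : ℕ := (s.filter fun b => f b < f a).card
  have hlt {a b : α} (ha : a ∈ s) (hab : f a < f b) : rank a < rank b := by
    refine Finset.card_lt_card ⟨fun c hc => ?_, fun hsub => ?_⟩
    · rw [Finset.mem_filter] at hc ⊢
      exact ⟨hc.1, hc.2.trans hab⟩
    · exact lt_irrefl _ (Finset.mem_filter.1 (hsub (Finset.mem_filter.2 ⟨ha, hab⟩))).2
  have hinj : Set.InjOn rank s := by
    intro a ha b hb hab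
    by_contra hne
    rcases lt_or_gt_of_ne (fun h => hne (hf ha hb h)) with h | h
    · exact (hlt ha h).ne hab
    · exact (hlt hb h).ne' hab
  -- Ranks are distinct and below `s.card`, so they take each of these values exactly once.
  have himage : s.image rank = Finset.range s.card := by
    refine Finset.eq_of_subset_of_card_le (fun r hr => ?_) ?_
    · obtain ⟨a, ha, rfl⟩ := Finset.mem_image.1 hr
      refine Finset.mem_range.2 (Finset.card_lt_card ⟨Finset.filter_subset _ _, fun hsub => ?_⟩)
      exact lt_irrefl _ (Finset.mem_filter.1 (hsub ha)).2
    · rw [Finset.card_range, Finset.card_image_of_injOn hinj]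
  have h : (s.filter fun a => rank a < k).image rank = Finset.range k := by
    rw [← Finset.filter_image (p := fun r => r < k), himage]
    ext r
    simp only [Finset.mem_filter, Finset.mem_range]
    omega
  rw [← Finset.card_image_of_injOn (hinj.mono (Finset.coe_subset.2 (Finset.filter_subset _ _))), h,
    Finset.card_range]

open scoped Classical in
/-- If distances are distinct, then every point has exactly `k` near neighbours. -/
theorem card_isNearNeighbor {d n k : ℕ} {x : Fin n → EuclideanSpace ℝ (Fin d)} (hk : k < n)
    (hx : ∀ i j l, j ≠ i → l ≠ i → dist (x i) (x j) = dist (x i) (x l) → j = l) (i : Fin n) :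
    (Finset.univ.filter fun j => IsNearNeighbor k x i j).card = k := by
  have h := card_filter_card_lt (Finset.univ.erase i) (fun j => dist (x i) (x j))
    (fun j hj l hl => hx i j l (Finset.ne_of_mem_erase hj) (Finset.ne_of_mem_erase hl)) k
    (by rw [Finset.card_erase_of_mem (Finset.mem_univ i), Finset.card_univ, Fintype.card_fin]
        omega)
  refine (congrArg Finset.card ?_).trans h
  ext j
  rw [Finset.mem_filter, Finset.mem_filter, IsNearNeighbor, ← Set.ncard_coe_finset]
  simp

open scoped Classical in
/-- The pairs `(i, j)` related by `R` for which the coin shows `true`. -/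
noncomputable def chosenPairs {n : ℕ} (R : Fin n → Fin n → Prop) (b : Fin n × Fin n → Bool) :
    Finset (Fin n × Fin n) :=
  Finset.univ.filter fun e => R e.1 e.2 ∧ b e = true

open scoped Classical in
/-- The chosen pairs whose reversal is also chosen. -/
noncomputable def mutualPairs {n : ℕ} (R : Fin n → Fin n → Prop) (b : Fin n × Fin n → Bool) :
    Finset (Fin n × Fin n) :=
  (chosenPairs R b).filter fun e => e.swap ∈ chosenPairs R b

/-- Every edge comes from one chosen pair, or from two that are mutual. -/
theorem two_mul_ncard_edgeSet_add {n : ℕ} (R : Fin n → Fin n → Prop) (hR : ∀ i, ¬ R i i)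
    (b : Fin n × Fin n → Bool) :
    2 * (SimpleGraph.fromRel fun i j => R i j ∧ b (i, j) = true).edgeSet.ncard +
      (mutualPairs R b).card = 2 * (chosenPairs R b).card := by
  classical
  set G := SimpleGraph.fromRel fun i j => R i j ∧ b (i, j) = true with hG
  -- Inclusion–exclusion for `D` and its reversal: the union is the set of ordered adjacent pairs,
  -- twice the edges, and the intersection is the set of mutual pairs.
  let D := chosenPairs R b
  have hswap : (D.image Prod.swap).card = D.card :=
    Finset.card_image_of_injective _ Prod.swap_injective
  have hinter : D ∩ D.image Prod.swap = mutualPairs R b := by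
    ext e
    simp only [Finset.mem_inter, mutualPairs, Finset.mem_filter, D, Finset.mem_image]
    refine and_congr_right fun _ => ⟨?_, fun h => ⟨_, h, Prod.swap_swap e⟩⟩
    rintro ⟨e', he', rfl⟩
    rwa [Prod.swap_swap]
  have hunion : D ∪ D.image Prod.swap = Finset.univ.filter fun e => G.Adj e.1 e.2 := by
    ext ⟨i, j⟩
    simp only [Finset.mem_union, Finset.mem_image, D, chosenPairs, Finset.mem_filter,
      Finset.mem_univ, true_and, hG, SimpleGraph.fromRel_adj, Prod.exists, Prod.swap_prod_mk,
      Prod.mk.injEq]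
    constructor
    · rintro (h | ⟨j', i', h, rfl, rfl⟩)
      · exact ⟨fun hij => hR i (hij ▸ h.1), Or.inl h⟩
      · exact ⟨fun hij => hR j' (hij ▸ h.1), Or.inr h⟩
    · rintro ⟨-, h | h⟩
      · exact Or.inl h
      · exact Or.inr ⟨j, i, h, rfl, rfl⟩
  have hedges : (Finset.univ.filter fun e : Fin n × Fin n => G.Adj e.1 e.2).card =
      2 * G.edgeSet.ncard := by
    rw [← SimpleGraph.coe_edgeFinset, Set.ncard_coe_finset,
      ← SimpleGraph.sum_degrees_eq_twice_card_edges, Finset.card_filter, Fintype.sum_prod_type]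
    refine Finset.sum_congr rfl fun i _ => ?_
    rw [← Finset.card_filter, ← SimpleGraph.card_neighborFinset_eq_degree]
    congr 1
    ext j
    simp
  have := Finset.card_union_add_card_inter D (D.image Prod.swap)
  rw [hunion, hinter, hedges, hswap] at this
  change _ = 2 * D.card
  omega

/-- Chebyshev's inequality for the number of coins in `S` that show `true`. -/
theorem measureReal_abs_card_coins_sub_ge {ι : Type*} [Fintype ι] (p : unitInterval)
    (S : Finset ι) {c : ℝ} (hc : 0 < c) :
    (Measure.pi fun _ : ι => bernoulliMeasure true false p).real
      {b | c ≤ |((S.filter fun e => b e = true).card : ℝ) - S.card * p|} ≤ S.card * p / c ^ 2 := by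
  classical
  set ν := Measure.pi fun _ : ι => bernoulliMeasure true false p
  let g : Bool → ℝ := fun t => if t = true then 1 else 0
  let X (e : ι) (b : ι → Bool) : ℝ := g (b e)
  have hmem (e : ι) : MemLp (X e) 2 ν := by
    refine MemLp.of_bound (measurable_of_finite _).aestronglyMeasurable 1
      (Eventually.of_forall fun b => ?_)
    by_cases h : b e = true <;> simp [X, g, h]
  have hmean (e : ι) (f : Bool → ℝ) : ∫ b, f (b e) ∂ν = p * f true + (1 - p) * f false := by
    have hmp := measurePreserving_eval (fun _ : ι => bernoulliMeasure true false p) e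
    rw [← smul_eq_mul, ← smul_eq_mul, ← integral_bernoulliMeasure, ← hmp.map_eq,
      integral_map (measurable_pi_apply e).aemeasurable (measurable_of_finite _).aestronglyMeasurable]
  have hindep : iIndepFun X ν :=
    iIndepFun_pi (X := fun _ : ι => g) fun _ => (measurable_of_finite _).aemeasurable
  have hvar : Var[∑ e ∈ S, X e; ν] ≤ S.card * p := by
    rw [IndepFun.variance_sum (fun e _ => hmem e) fun e _ e' _ hne => hindep.indepFun hne]
    refine (Finset.sum_le_card_nsmul _ _ (p : ℝ) fun e _ => ?_).trans_eq (by simp)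
    refine (variance_le_expectation_sq (hmem e).1).trans_eq ?_
    refine (hmean e fun t => g t ^ 2).trans ?_
    simp [g]
  have hexp : ∫ b, (∑ e ∈ S, X e) b ∂ν = S.card * p := by
    simp only [Finset.sum_apply]
    rw [integral_finsetSum _ fun e _ => (hmem e).integrable (by norm_num)]
    rw [Finset.sum_congr rfl fun e _ => hmean e g]
    simp [g]
  have hcheb := meas_ge_le_variance_div_sq (memLp_finsetSum' S fun e _ => hmem e) hc
  rw [hexp] at hcheb
  have hset : {b : ι → Bool | c ≤ |((S.filter fun e => b e = true).card : ℝ) - S.card * p|} =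
      {b | c ≤ |(∑ e ∈ S, X e) b - S.card * p|} := by
    ext b
    simp [X, g, Finset.sum_apply]
  rw [hset, measureReal_def]
  refine (ENNReal.toReal_mono ENNReal.ofReal_ne_top hcheb).trans ?_
  rw [ENNReal.toReal_ofReal (by have := variance_nonneg (∑ e ∈ S, X e) ν; positivity)]
  gcongr

open scoped Classical in
/-- Markov's inequality for the number of mutual pairs. -/
theorem measureReal_card_mutualPairs_ge {n : ℕ} (p : unitInterval) (R : Fin n → Fin n → Prop)
    (hR : ∀ i, ¬ R i i) {c : ℝ} (hc : 0 < c) :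
    (Measure.pi fun _ : Fin n × Fin n => bernoulliMeasure true false p).real
      {b | c ≤ (mutualPairs R b).card} ≤
      (Finset.univ.filter fun e : Fin n × Fin n => R e.1 e.2).card * (p : ℝ) ^ 2 / c := by
  set ν := Measure.pi fun _ : Fin n × Fin n => bernoulliMeasure true false p
  set S := Finset.univ.filter fun e : Fin n × Fin n => R e.1 e.2 with hS
  -- Both coins must show `true`. That `R` also holds for the reversed pair is dropped, which only
  -- increases the count.
  let E (e : Fin n × Fin n) : Set (Fin n × Fin n → Bool) :=
    {b | ∀ e' ∈ ({e, e.swap} : Finset _), b e' = true}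
  have hE : ∀ e ∈ S, ν.real (E e) = (p : ℝ) ^ 2 := by
    intro e he
    have hne : e ≠ e.swap := by
      intro h
      have h1 : e.1 = e.2 := congrArg Prod.fst h
      refine hR e.1 ?_
      have := (Finset.mem_filter.1 he).2
      rwa [← h1] at this
    rw [measureReal_def, bernoulli_pi_forall, bernoulli_singleton_true, Finset.card_pair hne,
      ENNReal.toReal_pow, ENNReal.toReal_ofReal p.2.1]
  have hle (b : Fin n × Fin n → Bool) :
      ((mutualPairs R b).card : ℝ) ≤ ∑ e ∈ S, (E e).indicator 1 b := by
    have h1 : (mutualPairs R b).card ≤ (S.filter fun e => b ∈ E e).card := by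
      refine Finset.card_le_card fun e he => ?_
      simp only [mutualPairs, chosenPairs, Finset.mem_filter, Finset.mem_univ, true_and] at he
      refine Finset.mem_filter.2 ⟨Finset.mem_filter.2 ⟨Finset.mem_univ _, he.1.1⟩, ?_⟩
      simp only [E, Set.mem_ofPred_eq, Finset.mem_insert, Finset.mem_singleton, forall_eq_or_imp,
        forall_eq]
      exact ⟨he.1.2, he.2.2⟩
    refine (Nat.cast_le.2 h1).trans_eq ?_
    rw [Finset.card_filter, Nat.cast_sum]
    refine Finset.sum_congr rfl fun e _ => ?_
    by_cases h : b ∈ E e <;> simp [h]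
  have hmarkov := mul_meas_ge_le_integral_of_nonneg (μ := ν)
    (f := fun b => ∑ e ∈ S, (E e).indicator 1 b)
    (Eventually.of_forall fun b => Finset.sum_nonneg fun e _ =>
      Set.indicator_nonneg (fun _ _ => zero_le_one) _) (Integrable.of_finite) c
  have hint : ∫ b, ∑ e ∈ S, (E e).indicator (1 : (Fin n × Fin n → Bool) → ℝ) b ∂ν =
      S.card * (p : ℝ) ^ 2 := by
    rw [integral_finsetSum _ fun e _ => Integrable.of_finite]
    rw [Finset.sum_congr rfl fun e he =>
      (integral_indicator_one (μ := ν) (Set.toFinite (E e)).measurableSet).trans (hE e he)]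
    simp
  rw [hint] at hmarkov
  rw [le_div_iff₀ hc, mul_comm]
  refine le_trans (mul_le_mul_of_nonneg_left ?_ hc.le) hmarkov
  exact measureReal_mono (fun b hb => le_trans hb (hle b)) (measure_ne_top ν _)

/-- If the distances are distinct, then the number of edges is concentrated around `n k p`. -/
theorem measureReal_abs_ncard_edgeSet_sub {d n k : ℕ} (hk : k < n) (p : unitInterval)
    {x : Fin n → EuclideanSpace ℝ (Fin d)}
    (hx : ∀ i j l, j ≠ i → l ≠ i → dist (x i) (x j) = dist (x i) (x l) → j = l)
    {c : ℝ} (hc : 0 < c) :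
    (Measure.pi fun _ : Fin n × Fin n => bernoulliMeasure true false p).real
      {b | ¬ |((nearNeighborGraph k (x, b)).edgeSet.ncard : ℝ) - n * k * p| ≤ 2 * c} ≤
      n * k * p / c ^ 2 + n * k * (p : ℝ) ^ 2 / c := by
  classical
  set S := Finset.univ.filter fun e : Fin n × Fin n => IsNearNeighbor k x e.1 e.2 with hS
  have hcard : S.card = n * k := by
    rw [hS, Finset.card_filter, Fintype.sum_prod_type]
    simp only [← Finset.card_filter]
    rw [Finset.sum_congr rfl fun i _ => (by convert card_isNearNeighbor hk hx i)]
    simp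
  have h1 := measureReal_abs_card_coins_sub_ge p S hc
  have h2 := measureReal_card_mutualPairs_ge p (IsNearNeighbor k x) (fun i h => h.1 rfl) hc
  have hcard' : (Finset.univ.filter fun e : Fin n × Fin n => IsNearNeighbor k x e.1 e.2).card =
    n * k := by convert hcard
  rw [hcard] at h1
  simp only [hcard'] at h2
  push_cast at h1 h2
  refine le_trans (measureReal_mono ?_) ((measureReal_union_le _ _).trans (add_le_add h1 h2))
  intro b hb
  by_contra hcon
  simp only [Set.mem_union, Set.mem_ofPred_eq, not_or, not_le] at hcon
  apply hb
  have hedge := two_mul_ncard_edgeSet_add (IsNearNeighbor k x) (fun i h => h.1 rfl) b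
  have hedge' : 2 * ((nearNeighborGraph k (x, b)).edgeSet.ncard : ℝ) +
      (mutualPairs (IsNearNeighbor k x) b).card =
      2 * (chosenPairs (IsNearNeighbor k x) b).card := by exact_mod_cast hedge
  have hD : chosenPairs (IsNearNeighbor k x) b = S.filter fun e => b e = true := by
    ext e
    simp [chosenPairs, hS]
  rw [hD] at hedge'
  -- The edge count is the number of successes, off by less than `c`, minus half the mutual pairs,
  -- less than `c / 2`.
  have hA := abs_lt.1 hcon.1
  have hB := hcon.2
  have hB0 : (0 : ℝ) ≤ (mutualPairs (IsNearNeighbor k x) b).card := Nat.cast_nonneg _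
  rw [abs_le]
  constructor <;> linarith

/-! ### Choice of parameters and limits -/

instance isProbabilityMeasure_sampleLaw (d n : ℕ) (p : unitInterval) :
    IsProbabilityMeasure (sampleLaw d n p) := by
  unfold sampleLaw
  infer_instance

/-- Round `Y ^ (1 / d)` down to `M`; as `M ≥ 1`, it is below `M + 1 ≤ 2 * M`. -/
theorem exists_pow_le_le_two_mul_pow {d : ℕ} (hd : 1 ≤ d) {Y : ℝ} (hY : 1 ≤ Y) :
    ∃ M : ℕ, 0 < M ∧ (M : ℝ) ^ d ≤ Y ∧ Y ≤ 2 ^ d * (M : ℝ) ^ d := by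
  have hY0 : 0 ≤ Y := by linarith
  set z : ℝ := Y ^ ((d : ℝ)⁻¹) with hz
  have hzd : z ^ d = Y := Real.rpow_inv_natCast_pow hY0 (by omega)
  have hz1 : 1 ≤ z := Real.one_le_rpow hY (by positivity)
  have hM : 1 ≤ ⌊z⌋₊ := Nat.one_le_floor_iff z |>.2 hz1
  have hM' : (1 : ℝ) ≤ ⌊z⌋₊ := by exact_mod_cast hM
  refine ⟨⌊z⌋₊, hM, ?_, ?_⟩
  · rw [← hzd]
    exact pow_le_pow_left₀ (by positivity) (Nat.floor_le (by linarith)) d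
  · rw [← hzd, ← mul_pow]
    exact pow_le_pow_left₀ (by linarith) (by linarith [Nat.lt_floor_add_one z]) d

/-- If the probabilities of the complements tend to zero, then the probabilities tend to one. -/
theorem tendsto_measure_one_of_compl {Ω : ℕ → Type*} [∀ n, MeasurableSpace (Ω n)]
    (μ : ∀ n, Measure (Ω n)) [∀ n, IsProbabilityMeasure (μ n)] (S : ∀ n, Set (Ω n)) {g : ℕ → ℝ}
    (hg : Tendsto g atTop (𝓝 0)) (h : ∀ᶠ n in atTop, (μ n).real (S n)ᶜ ≤ g n) :
    Tendsto (fun n => μ n (S n)) atTop (𝓝 1) := by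
  have hreal : Tendsto (fun n => (μ n).real (S n)) atTop (𝓝 1) := by
    refine tendsto_of_tendsto_of_tendsto_of_le_of_le' (g := fun n => 1 - g n)
      (by simpa using hg.const_sub 1) tendsto_const_nhds ?_
      (Eventually.of_forall fun n => measureReal_le_one)
    filter_upwards [h] with n hn
    have := measureReal_union_le (μ := μ n) (S n) (S n)ᶜ
    rw [Set.union_compl_self, probReal_univ] at this
    linarith
  have := ENNReal.tendsto_ofReal hreal
  simpa using this

theorem tendsto_log_natCast : Tendsto (fun n : ℕ => Real.log n) atTop atTop :=
  Real.tendsto_log_atTop.comp tendsto_natCast_atTop_atTop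

theorem tendsto_log_log_natCast : Tendsto (fun n : ℕ => Real.log (Real.log n)) atTop atTop :=
  Real.tendsto_log_atTop.comp tendsto_log_natCast

theorem tendsto_log_log_div_log :
    Tendsto (fun n : ℕ => Real.log (Real.log n) / Real.log n) atTop (𝓝 0) :=
  (Real.isLittleO_log_id_atTop.tendsto_div_nhds_zero).comp tendsto_log_natCast

theorem eventually_connectProb_eq :
    ∀ᶠ n : ℕ in atTop, (connectProb 1 n : ℝ) = Real.log (Real.log n) / Real.log n := by
  filter_upwards [tendsto_log_log_div_log.eventually_le_const zero_lt_one,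
    tendsto_log_natCast.eventually_ge_atTop 0,
    tendsto_log_log_natCast.eventually_ge_atTop 0] with n h1 h2 h3
  rw [connectProb, one_mul, Set.projIcc_of_mem _ ⟨div_nonneg h3 h2, h1⟩]

/-- The failure probability for the giant component. -/
theorem measureReal_no_giant_le {d n : ℕ} (hd : 1 ≤ d) {K w : ℝ}
    (hK : K = (4 * d + 1 : ℝ) ^ d * (36 * 2 ^ d)) (hn : 12 * Real.log n ≤ n)
    (hlog : 1 ≤ Real.log n) (hw : 1 ≤ w) (hw2 : 3 + 72 * 2 ^ d ≤ w ^ 2)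
    (hp : (connectProb 1 n : ℝ) = w ^ 4 / Real.log n) :
    (sampleLaw d n (connectProb 1 n)).real
      {ω | ∃ C : (nearNeighborGraph (numNeighbors (K + 1) n) ω).ConnectedComponent,
        (n : ℝ) - n / w ≤ C.supp.ncard}ᶜ ≤ 3 * (n : ℝ)⁻¹ := by
  set l := Real.log n with hl
  have hl0 : 0 < l := by linarith
  have hn0 : (0 : ℝ) < n := by linarith
  have hexp : Real.exp l = n := Real.exp_log hn0
  -- The mean cell count `y` lies between `12 l` and `2 ^ d * 12 l`. The `12` gives `3 * s ≤ y / 4`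
  -- for `s ≤ l`, and a Chernoff bound `exp (-y / 3)` that beats the number of cells.
  obtain ⟨M, hM, hMle, hMge⟩ := exists_pow_le_le_two_mul_pow hd (Y := n / (12 * l))
    ((one_le_div (by positivity)).2 hn)
  have hMpos : (0 : ℝ) < (M : ℝ) ^ d := by positivity
  set y : ℝ := n / M ^ d with hy
  have hy1 : 12 * l ≤ y := by
    rw [hy, le_div_iff₀ hMpos, mul_comm]
    rwa [le_div_iff₀ (by positivity)] at hMle
  have hy2 : y ≤ 2 ^ d * (12 * l) := by
    rw [div_le_iff₀ (by positivity)] at hMge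
    rw [hy, div_le_iff₀ hMpos]
    linarith
  have hMn : (M : ℝ) ^ d ≤ n := hMle.trans (div_le_self hn0.le (by linarith))
  set s : ℝ := l / w with hs
  have hs0 : 0 < s := by positivity
  have hsl : s ≤ l := div_le_self hl0.le hw
  have hps : (connectProb 1 n : ℝ) * s ^ 2 = l * w ^ 2 := by
    rw [hp, hs]
    field_simp
  -- The extra `1` in `K + 1` contributes `l ≥ 1`, which absorbs the rounding down.
  have hk : (4 * d + 1 : ℝ) ^ d * (3 * y) < numNeighbors (K + 1) n := by
    have h1 : (4 * d + 1 : ℝ) ^ d * (3 * y) ≤ K * l := by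
      rw [hK, mul_assoc]
      refine mul_le_mul_of_nonneg_left ?_ (by positivity)
      linarith
    have h2 : (K + 1) * l < numNeighbors (K + 1) n + 1 := Nat.lt_floor_add_one _
    linarith
  have hfs : (M : ℝ) ^ d * s ≤ n / w := by
    rw [hs, mul_div_assoc', div_le_div_iff_of_pos_right (by linarith)]
    rw [le_div_iff₀ (by positivity)] at hMle
    nlinarith
  have hsub : {ω : Outcome d n | ∃ C : (nearNeighborGraph (numNeighbors (K + 1) n)
        ω).ConnectedComponent, (n : ℝ) - n / w ≤ C.supp.ncard}ᶜ ⊆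
      {ω | ¬ ∃ C : (nearNeighborGraph (numNeighbors (K + 1) n) ω).ConnectedComponent,
        (n : ℝ) - M ^ d * s ≤ C.supp.ncard} := by
    rintro ω hω ⟨C, hC⟩
    exact hω ⟨C, le_trans (by linarith) hC⟩
  have hmeas : MeasurableSet {ω : Outcome d n | ¬ ∃ C : (nearNeighborGraph
      (numNeighbors (K + 1) n) ω).ConnectedComponent, (n : ℝ) - M ^ d * s ≤ C.supp.ncard} :=
    measurableSet_isNearNeighbor_coins (numNeighbors (K + 1) n) fun R b =>
      ¬ ∃ C : (SimpleGraph.fromRel fun i j => R i j ∧ b (i, j) = true).ConnectedComponent,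
        (n : ℝ) - M ^ d * s ≤ C.supp.ncard
  refine (measureReal_mono hsub).trans ?_
  have hmain := prod_real_le_add_of_slice_le (Measure.pi fun _ : Fin n => uniformCube d)
    (Measure.pi fun _ : Fin n × Fin n => bernoulliMeasure true false (connectProb 1 n)) hmeas
    {x | ¬ WellSpread M x}
    (ε := (M ^ d) ^ 2 * Real.exp (2 * (3 * (n / M ^ d)) - connectProb 1 n * s ^ 2)) (by positivity)
    fun x hx => WellSpread.measureReal_no_giant_le hM _ (not_not.1 hx) hk hs0
      (by rw [← hy]; linarith)
  refine hmain.trans ?_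
  have hgood := measureReal_not_wellSpread_le (d := d) (n := n) hM
  rw [← hy] at hgood ⊢
  have hinv : (n : ℝ)⁻¹ = Real.exp (-l) := by rw [Real.exp_neg, hexp]
  have hfirst : (M : ℝ) ^ d * (2 * Real.exp (-y / 3)) ≤ 2 * (n : ℝ)⁻¹ := by
    calc (M : ℝ) ^ d * (2 * Real.exp (-y / 3)) ≤ n * (2 * Real.exp (-(2 * l))) := by
          refine mul_le_mul hMn ?_ (by positivity) hn0.le
          gcongr
          linarith
      _ = 2 * (n : ℝ)⁻¹ := by
          rw [hinv, ← hexp, mul_left_comm, ← Real.exp_add]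
          congr 2
          ring
  have hsecond : ((M : ℝ) ^ d) ^ 2 * Real.exp (2 * (3 * y) - connectProb 1 n * s ^ 2) ≤
      (n : ℝ)⁻¹ := by
    calc ((M : ℝ) ^ d) ^ 2 * Real.exp (2 * (3 * y) - connectProb 1 n * s ^ 2) ≤
          (n : ℝ) ^ 2 * Real.exp (-(3 * l)) := by
          refine mul_le_mul (pow_le_pow_left₀ hMpos.le hMn 2) ?_ (by positivity) (by positivity)
          rw [hps, Real.exp_le_exp]
          -- Here `6 * y ≤ 72 * 2 ^ d * l`, while `l * w ^ 2 ≥ (3 + 72 * 2 ^ d) * l`.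
          nlinarith
      _ = (n : ℝ)⁻¹ := by
          rw [hinv, ← hexp, ← Real.exp_nat_mul, ← Real.exp_add]
          congr 1
          push_cast
          ring
  linarith

/-- The failure probability for the number of edges. -/
theorem measureReal_not_edges_le {d n : ℕ} (hd : 1 ≤ d) {c ε : ℝ} (hc : 0 < c) (hε : 0 < ε)
    (hn : c * Real.log n < n) (hlog : 0 < Real.log n) (hlogε : 2 ≤ ε * Real.log n)
    (hloglog : 0 < Real.log (Real.log n))
    (hp : (connectProb 1 n : ℝ) = Real.log (Real.log n) / Real.log n) :
    (sampleLaw d n (connectProb 1 n)).real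
      {ω | |((nearNeighborGraph (numNeighbors c n) ω).edgeSet.ncard : ℝ)
          - c * 1 * (n * Real.log (Real.log n))| ≤ ε * (n * Real.log (Real.log n))}ᶜ ≤
      16 * c / ε ^ 2 * (Real.log (Real.log n))⁻¹ +
        4 * c / ε * (Real.log (Real.log n) / Real.log n) := by
  set l := Real.log n with hl
  set L := Real.log l with hL
  set p : ℝ := ((connectProb 1 n : unitInterval) : ℝ)
  set k := numNeighbors c n with hk
  have hn0 : (0 : ℝ) < n := lt_trans (by positivity) hn
  have hn1 : (1 : ℝ) ≤ n := by exact_mod_cast Nat.one_le_iff_ne_zero.2 (by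
    rintro rfl; simp at hn0)
  have hk1 : (k : ℝ) ≤ c * l := Nat.floor_le (by positivity)
  have hk2 : c * l < k + 1 := Nat.lt_floor_add_one _
  have hkn : k < n := by exact_mod_cast hk1.trans_lt hn
  have hp0 : 0 < p := by rw [hp]; positivity
  have hpl : p * l = L := by rw [hp]; field_simp
  have hkp : (k : ℝ) * p ≤ c * L := by
    rw [← hpl]; nlinarith
  -- Rounding `k` down costs at most one `p`, and this is at most `ε / 2 * L` by `hpε`. The other
  -- half of `ε` is left for the random fluctuation.
  have hkp' : c * L - p ≤ k * p := by
    rw [← hpl]; nlinarith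
  have hpε : p ≤ ε / 2 * L := by
    rw [← hpl]; nlinarith
  have hsub : {ω : Outcome d n | |((nearNeighborGraph k ω).edgeSet.ncard : ℝ)
        - c * 1 * (n * L)| ≤ ε * (n * L)}ᶜ ⊆
      {ω | ¬ |((nearNeighborGraph k ω).edgeSet.ncard : ℝ) - n * k * p| ≤
        2 * (ε / 4 * (n * L))} := by
    intro ω hω h
    apply hω
    rw [abs_le] at h
    have h1 : (n : ℝ) * (k * p) ≤ n * (c * L) := mul_le_mul_of_nonneg_left hkp hn0.le
    have h2 : (n : ℝ) * (c * L - p) ≤ n * (k * p) := mul_le_mul_of_nonneg_left hkp' hn0.le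
    have h3 : (n : ℝ) * p ≤ n * (ε / 2 * L) := mul_le_mul_of_nonneg_left hpε hn0.le
    have h4 : 0 ≤ ε * (n * L) := by positivity
    rw [Set.mem_ofPred_eq, abs_le]
    constructor <;> nlinarith
  have hmeas : MeasurableSet {ω : Outcome d n |
      ¬ |((nearNeighborGraph k ω).edgeSet.ncard : ℝ) - n * k * p| ≤ 2 * (ε / 4 * (n * L))} :=
    measurableSet_isNearNeighbor_coins k fun R b =>
      ¬ |((SimpleGraph.fromRel fun i j => R i j ∧ b (i, j) = true).edgeSet.ncard : ℝ)
        - n * k * p| ≤ 2 * (ε / 4 * (n * L))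
  have hmain := prod_real_le_add_of_slice_le (Measure.pi fun _ : Fin n => uniformCube d)
    (Measure.pi fun _ : Fin n × Fin n => bernoulliMeasure true false (connectProb 1 n)) hmeas
    {x | ¬ ∀ i j l, j ≠ i → l ≠ i → dist (x i) (x j) = dist (x i) (x l) → j = l}
    (by positivity)
    fun x hx => measureReal_abs_ncard_edgeSet_sub hkn (connectProb 1 n) (not_not.1 hx)
      (c := ε / 4 * (n * L)) (by positivity)
  have hnull : (Measure.pi fun _ : Fin n => uniformCube d).real
      {x | ¬ ∀ i j l, j ≠ i → l ≠ i → dist (x i) (x j) = dist (x i) (x l) → j = l} = 0 := by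
    rw [measureReal_def, ae_iff.1 (ae_injOn_dist hd n), ENNReal.toReal_zero]
  rw [hnull, zero_add] at hmain
  refine (measureReal_mono hsub).trans (hmain.trans (add_le_add ?_ ?_))
  · calc (n : ℝ) * k * p / (ε / 4 * (n * L)) ^ 2 ≤ n * (c * L) / (ε / 4 * (n * L)) ^ 2 := by
          rw [mul_assoc]; gcongr
      _ = 16 * c / ε ^ 2 * L⁻¹ / n := by field_simp; ring
      _ ≤ 16 * c / ε ^ 2 * L⁻¹ := div_le_self (by positivity) hn1
  · calc (n : ℝ) * k * p ^ 2 / (ε / 4 * (n * L)) = n * (k * p) * p / (ε / 4 * (n * L)) := by ring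
      _ ≤ n * (c * L) * p / (ε / 4 * (n * L)) := by gcongr
      _ = 4 * c / ε * (L / l) := by rw [hp]; field_simp

theorem theorem2 (d : ℕ) (hd : 1 ≤ d) :
    ∃ c₁ c₂ : ℝ, 0 < c₁ ∧ 0 < c₂ ∧
      (∃ f : ℕ → ℝ, f =o[atTop] (fun n : ℕ => (n : ℝ)) ∧
        Tendsto (fun n : ℕ => sampleLaw d n (connectProb c₂ n)
            {ω | ∃ C : (nearNeighborGraph (numNeighbors c₁ n) ω).ConnectedComponent,
              (n : ℝ) - f n ≤ (C.supp.ncard : ℝ)})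
          atTop (𝓝 1)) ∧
      (∀ ε : ℝ, 0 < ε →
        Tendsto (fun n : ℕ => sampleLaw d n (connectProb c₂ n)
            {ω | |((nearNeighborGraph (numNeighbors c₁ n) ω).edgeSet.ncard : ℝ)
                - c₁ * c₂ * (n * Real.log (Real.log n))| ≤ ε * (n * Real.log (Real.log n))})
          atTop (𝓝 1)) := by
  set K : ℝ := (4 * d + 1 : ℝ) ^ d * (36 * 2 ^ d) with hK
  have hK0 : 0 < K := by positivity
  have hlogn (C : ℝ) : ∀ᶠ n : ℕ in atTop, C * Real.log n < n := by
    have h0 : Tendsto (fun n : ℕ => C * (Real.log n / n)) atTop (𝓝 (C * 0)) :=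
      ((Real.isLittleO_log_id_atTop.tendsto_div_nhds_zero).comp
        tendsto_natCast_atTop_atTop).const_mul C
    rw [mul_zero] at h0
    filter_upwards [h0.eventually_lt_const zero_lt_one, eventually_gt_atTop 0] with n h1 h2
    have h3 : (0 : ℝ) < n := by exact_mod_cast h2
    rwa [mul_div_assoc', div_lt_one h3] at h1
  refine ⟨K + 1, 1, by positivity, one_pos, ?_, fun ε hε => ?_⟩
  -- The fourth root gives `p = w ^ 4 / log n`: then `p * s ^ 2 = w ^ 2 * log n` still outgrows
  -- every multiple of `log n`, so `c₂ = 1` suffices, and `n / w` is `o(n)`.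
  · let w (n : ℕ) : ℝ := Real.sqrt (Real.sqrt (Real.log (Real.log n)))
    have hw : Tendsto w atTop atTop :=
      Real.tendsto_sqrt_atTop.comp (Real.tendsto_sqrt_atTop.comp tendsto_log_log_natCast)
    refine ⟨fun n => n / w n, ?_, ?_⟩
    · have h : (fun n : ℕ => (n : ℝ) * (w n)⁻¹) =o[atTop] fun n : ℕ => (n : ℝ) * 1 :=
        (isBigO_refl _ _).mul_isLittleO ((isLittleO_one_iff ℝ).2 hw.inv_tendsto_atTop)
      simpa [div_eq_mul_inv] using h
    · refine tendsto_measure_one_of_compl _ _ (g := fun n => 3 * (n : ℝ)⁻¹) ?_ ?_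
      · simpa using (tendsto_inv_atTop_nhds_zero_nat (𝕜 := ℝ)).const_mul 3
      · filter_upwards [hlogn 12, tendsto_log_natCast.eventually_ge_atTop 1,
          hw.eventually_ge_atTop 1, hw.eventually_ge_atTop (3 + 72 * 2 ^ d),
          tendsto_log_log_natCast.eventually_ge_atTop 0, eventually_connectProb_eq]
          with n h1 h2 h3 h4 h5 h6
        refine measureReal_no_giant_le hd hK h1.le h2 h3 (by nlinarith) ?_
        rw [h6]
        congr 1
        calc Real.log (Real.log n) = Real.sqrt (Real.log (Real.log n)) ^ 2 := (Real.sq_sqrt h5).symm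
          _ = (w n ^ 2) ^ 2 := by rw [Real.sq_sqrt (Real.sqrt_nonneg _)]
          _ = w n ^ 4 := by ring
  · refine tendsto_measure_one_of_compl _ _ (g := fun n : ℕ =>
      16 * (K + 1) / ε ^ 2 * (Real.log (Real.log n))⁻¹ +
        4 * (K + 1) / ε * (Real.log (Real.log n) / Real.log n)) ?_ ?_
    · simpa using (tendsto_log_log_natCast.inv_tendsto_atTop.const_mul
        (16 * (K + 1) / ε ^ 2)).add (tendsto_log_log_div_log.const_mul (4 * (K + 1) / ε))
    · filter_upwards [hlogn (K + 1), tendsto_log_natCast.eventually_gt_atTop 0,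
        tendsto_log_natCast.eventually_ge_atTop (2 / ε),
        tendsto_log_log_natCast.eventually_gt_atTop 0, eventually_connectProb_eq]
        with n h1 h2 h3 h4 h5
      exact measureReal_not_edges_le hd (by positivity) hε h1 h2
        (by rwa [div_le_iff₀' hε] at h3) h4 h5
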